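/- Conventions. A zero-dimensional compactification of a topological space $X$ is a compact Hausdorff space $Y$ together with a homeomorphism of $X$ onto a dense subspace of $Y$ (with which $X$ is identified) such that the remainder $Y\setminus X$ has a base of closed-open sets. The Freudenthal compactification $\varepsilon X$ is the maximal one, i.e. the one that maps continuously and identically on $X$ to every other. The ends of $X$ are the points of $\varepsilon X\setminus X$; $X$ has one end if $\varepsilon X\setminus X$ is a single point. In a metric space $(X,d)$ let $\rho(x)\in[0,+\infty]$ be the supremum of all $r>0$ such that the open ball $B(x,r)$ has compact closure; write $x\,\mathcal R\,y$ if $d(x,y)<\rho(x)$, let $\mathcal R^*$ be the transitive closure of $\mathcal R$, and let $x\,\mathcal E\,y$ mean that $x=y$, or $x\,\mathcal R^*y$ and $y\,\mathcal R^*x$. The pseudo-components of $X$ are the equivalence classes of $\mathcal E$. The group $G$ of (surjective) isometries of $X$ carries the topology of pointwise convergence and acts on $X$ by evaluation; it acts properly on an invariant subset $A\subseteq X$ if the map $G\times A\to A\times A$, $(g,x)\mapsto(gx,x)$, is proper. Theorem 1.1. Let $(X,d)$ be a locally compact metric space with one end and let $G$ be its group of isometries. (i) $X$ has only finitely many pseudo-components,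 exactly one of which is not compact, and $G$ is locally compact. (ii) Let $P$ be the non-compact pseudo-component. Then $P$ is $G$-invariant, $G$ acts properly on $P$, and $X\setminus P$ is a compact subset of $X$. However, $G$ may fail to act properly on $X\setminus P$: there is a locally compact metric space with one end, with non-compact pseudo-component $P$, such that its group of isometries does not act properly on the (invariant) set $X\setminus P$. -/

import Mathlib

open Topology
open scoped ENNReal

universe u

/-! ### Ends via the Freudenthal (end-point) compactification -/

/-- `ι : X → Y` is a zero-dimensional compactification of `X`: `Y` is a compact Hausdorff space,
`ι` is a homeomorphism onto a dense subspace, and the remainder `Y ∖ ι(X)`, with the subspace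
topology, has a base of closed-open sets. -/
structure IsZeroDimCompactification {X Y : Type u} [TopologicalSpace X] [TopologicalSpace Y]
    (ι : X → Y) : Prop where
  compactSpace : CompactSpace Y
  t2Space : T2Space Y
  isDenseEmbedding : IsDenseEmbedding ι
  isTopologicalBasis_isClopen :
    TopologicalSpace.IsTopologicalBasis {s : Set ↥((Set.range ι)ᶜ) | IsClopen s}

/-- `ι : X → Y` is a Freudenthal (end-point) compactification of `X`: the maximal
zero-dimensional compactification, that is, it maps continuously, over `X`, to every other one.
(It suffices to test against compactifications in the universe of `X`, since a Hausdorff space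
with a dense subset `X` has at most `2 ^ 2 ^ |X|` points.) -/
structure IsFreudenthalCompactification {X Y : Type u} [TopologicalSpace X] [TopologicalSpace Y]
    (ι : X → Y) : Prop where
  isZeroDimCompactification : IsZeroDimCompactification ι
  maximal : ∀ (Z : Type u) [TopologicalSpace Z] (j : X → Z), IsZeroDimCompactification j →
    ∃ f : Y → Z, Continuous f ∧ f ∘ ι = j

/-- `X` has exactly one end: the remainder of its Freudenthal compactification, whose points are
the ends of `X`, consists of exactly one point. -/
def HasOneEnd (X : Type u) [TopologicalSpace X] : Prop :=
  ∃ (Y : Type u) (_ : TopologicalSpace Y) (ι : X → Y),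
    IsFreudenthalCompactification ι ∧ ∃! e : Y, e ∉ Set.range ι

/-! ### Pseudo-components -/

section PseudoComponents

variable {X : Type u} [MetricSpace X]

/-- The radius of compactness of `x`: the supremum, in `[0, ∞]`, of all `r > 0` for which the open
ball of radius `r` around `x` has compact closure. -/
noncomputable def compactnessRadius (x : X) : ℝ≥0∞ :=
  ⨆ (r : ℝ) (_ : 0 < r ∧ IsCompact (closure (Metric.ball x r))), ENNReal.ofReal r

/-- The directed graph `x 𝓡 y ↔ d(x, y) < ρ(x)`. -/
def CompactnessRel (x y : X) : Prop :=
  edist x y < compactnessRadius x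

/-- `x 𝓔 y` iff `x = y`, or `x 𝓡* y` and `y 𝓡* x`, where `𝓡*` is the transitive closure of
`𝓡`. -/
def PseudoEquiv (x y : X) : Prop :=
  x = y ∨ (Relation.TransGen CompactnessRel x y ∧ Relation.TransGen CompactnessRel y x)

theorem pseudoEquiv_equivalence : Equivalence (PseudoEquiv (X := X)) where
  refl _ := Or.inl rfl
  symm h := h.elim (fun h => Or.inl h.symm) (fun h => Or.inr ⟨h.2, h.1⟩)
  trans := by
    rintro x y z (rfl | h) (rfl | k)
    · exact Or.inl rfl
    · exact Or.inr k
    · exact Or.inr h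
    · exact Or.inr ⟨h.1.trans k.1, k.2.trans h.2⟩

variable (X) in
/-- The pseudo-components of `X`: the equivalence classes of `𝓔`. -/
def pseudoComponents : Set (Set X) :=
  (Setoid.mk PseudoEquiv (pseudoEquiv_equivalence (X := X))).classes

end PseudoComponents

/-! ### The group of isometries -/

section IsometryGroup

variable {X : Type u} [MetricSpace X]

/-- The topology of pointwise convergence on the group of (surjective) isometries of `X`. -/
instance isometryGroupTopology : TopologicalSpace (X ≃ᵢ X) :=
  TopologicalSpace.induced (fun (g : X ≃ᵢ X) (x : X) => g x) Pi.topologicalSpace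

/-- The natural evaluation action of the group of isometries. -/
instance isometryGroupAction : MulAction (X ≃ᵢ X) X where
  smul g x := g x
  one_smul _ := rfl
  mul_smul _ _ _ := rfl

end IsometryGroup

/-! ### The radius of compactness and pseudo-components -/

section PseudoComponentLemmas

open Filter

variable {X : Type u} [MetricSpace X]

/-! The radius of compactness is invariant under isometries and 1-Lipschitz, so each
pseudo-component is open and any union of them is clopen (`isClopen_sUnion_pseudoComponents`). With
one end, a clopen set or its complement is compact (`HasOneEnd.isCompact_or_isCompact_compl`); this
gives finiteness, the unique non-compact `P` and compactness of `Pᶜ`. Isometries permute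
pseudo-components, hence preserve `P`.

If isometries converge at one point, they converge, along an ultrafilter, at every `𝓡`-successor
(`exists_tendsto_of_compactnessRel`), hence on the whole pseudo-component; on `Pᶜ` compactness
provides limits. The same holds for the inverses, so the limit is a surjective isometry
(`exists_le_nhds_of_tendsto_apply`). Local compactness of the group and properness on `P` both
follow.

For the counterexample, the plane's translations act on the plane plus an isolated point, which they
all fix. -/

theorem le_compactnessRadius {x : X} {r : ℝ} (hr : IsCompact (closure (Metric.ball x r))) :
    ENNReal.ofReal r ≤ compactnessRadius x := by
  rcases le_or_gt r 0 with h | h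
  · simp [ENNReal.ofReal_of_nonpos h]
  · exact le_iSup₂ (f := fun (r : ℝ) (_ : 0 < r ∧ IsCompact (closure (Metric.ball x r))) =>
      ENNReal.ofReal r) r ⟨h, hr⟩

theorem exists_isCompact_of_lt_compactnessRadius {x : X} {a : ℝ≥0∞}
    (h : a < compactnessRadius x) :
    ∃ r : ℝ, a < ENNReal.ofReal r ∧ IsCompact (closure (Metric.ball x r)) := by
  obtain ⟨r, hr⟩ := lt_iSup_iff.1 h
  obtain ⟨h1, h2⟩ := lt_iSup_iff.1 hr
  exact ⟨r, h2, h1.2⟩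

theorem compactnessRadius_le_add_edist (x y : X) :
    compactnessRadius x ≤ compactnessRadius y + edist x y := by
  refine iSup₂_le fun r hr => ?_
  have hsub : Metric.ball y (r - dist x y) ⊆ Metric.ball x r :=
    Metric.ball_subset_ball' (by rw [dist_comm y x]; linarith)
  calc ENNReal.ofReal r = ENNReal.ofReal ((r - dist x y) + dist x y) := by ring_nf
    _ ≤ ENNReal.ofReal (r - dist x y) + ENNReal.ofReal (dist x y) := ENNReal.ofReal_add_le
    _ ≤ _ := by
      rw [← edist_dist]
      gcongr
      exact le_compactnessRadius (hr.2.of_isClosed_subset isClosed_closure (closure_mono hsub))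

theorem compactnessRadius_pos [LocallyCompactSpace X] (x : X) : 0 < compactnessRadius x := by
  obtain ⟨K, hK, hx⟩ := exists_compact_mem_nhds x
  obtain ⟨r, hr, h⟩ := Metric.mem_nhds_iff.1 hx
  exact (ENNReal.ofReal_pos.2 hr).trans_le
    (le_compactnessRadius (hK.closure_of_subset h))

theorem compactnessRadius_isometryEquiv (g : X ≃ᵢ X) (x : X) :
    compactnessRadius (g x) = compactnessRadius x := by
  have key : ∀ (g : X ≃ᵢ X) (x : X), compactnessRadius x ≤ compactnessRadius (g x) := by
    refine fun g x => iSup₂_le fun r hr => le_compactnessRadius ?_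
    have := hr.2.image g.continuous
    rwa [← g.coe_toHomeomorph, g.toHomeomorph.image_closure, g.coe_toHomeomorph,
      g.image_ball] at this
  refine le_antisymm ?_ (key g x)
  simpa using key g.symm (g x)

theorem compactnessRel_isometryEquiv (g : X ≃ᵢ X) {x y : X} (h : CompactnessRel x y) :
    CompactnessRel (g x) (g y) := by
  unfold CompactnessRel at *
  rwa [compactnessRadius_isometryEquiv, g.edist_eq]

theorem pseudoEquiv_isometryEquiv (g : X ≃ᵢ X) {x y : X} (h : PseudoEquiv x y) :
    PseudoEquiv (g x) (g y) := by
  rcases h with rfl | ⟨h, k⟩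
  · exact Or.inl rfl
  · exact Or.inr ⟨h.lift g fun _ _ => compactnessRel_isometryEquiv g,
      k.lift g fun _ _ => compactnessRel_isometryEquiv g⟩

theorem pseudoEquiv_of_edist_lt {x y : X} (h : edist x y < compactnessRadius x / 2) :
    PseudoEquiv x y := by
  refine Or.inr ⟨.single (h.trans_le ENNReal.half_le_self), .single ?_⟩
  unfold CompactnessRel
  -- Otherwise ρ(x) ≤ ρ(y) + d(x,y) ≤ 2 d(x,y) < ρ(x).
  by_contra! hy
  rw [edist_comm] at hy
  have h1 := (compactnessRadius_le_add_edist x y).trans (add_le_add_left hy _)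
  have h2 := ENNReal.add_lt_add h h
  rw [ENNReal.add_halves] at h2
  exact absurd h1 h2.not_ge

theorem isOpen_of_pseudoEquiv_closed [LocallyCompactSpace X] {A : Set X}
    (hA : ∀ x ∈ A, ∀ y, PseudoEquiv x y → y ∈ A) : IsOpen A := by
  refine EMetric.isOpen_iff.2 fun x hx =>
    ⟨compactnessRadius x / 2, ENNReal.half_pos (compactnessRadius_pos x).ne', fun y hy => ?_⟩
  exact hA x hx y (pseudoEquiv_of_edist_lt (by rwa [edist_comm]))

theorem mem_of_pseudoEquiv {P : Set X} (hP : P ∈ pseudoComponents X) {x y : X} (hx : x ∈ P)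
    (h : PseudoEquiv x y) : y ∈ P := by
  obtain ⟨z, rfl⟩ := hP
  exact pseudoEquiv_equivalence.trans (pseudoEquiv_equivalence.symm h) hx

theorem pseudoEquiv_of_mem {P : Set X} (hP : P ∈ pseudoComponents X) {x y : X} (hx : x ∈ P)
    (hy : y ∈ P) : PseudoEquiv x y := by
  obtain ⟨z, rfl⟩ := hP
  exact pseudoEquiv_equivalence.trans hx (pseudoEquiv_equivalence.symm hy)

theorem isClopen_sUnion_pseudoComponents [LocallyCompactSpace X] {S : Set (Set X)}
    (hS : S ⊆ pseudoComponents X) : IsClopen (⋃₀ S) := by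
  refine ⟨⟨isOpen_of_pseudoEquiv_closed ?_⟩, isOpen_of_pseudoEquiv_closed ?_⟩
  · rintro x hx y hxy ⟨P, hP, hy⟩
    exact hx ⟨P, hP, mem_of_pseudoEquiv (hS hP) hy (pseudoEquiv_equivalence.symm hxy)⟩
  · rintro x ⟨P, hP, hx⟩ y hxy
    exact ⟨P, hP, mem_of_pseudoEquiv (hS hP) hx hxy⟩

theorem isClopen_of_mem_pseudoComponents [LocallyCompactSpace X] {P : Set X}
    (hP : P ∈ pseudoComponents X) : IsClopen P := by
  simpa using isClopen_sUnion_pseudoComponents (Set.singleton_subset_iff.2 hP)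

theorem exists_mem_pseudoComponents (x : X) : ∃ P ∈ pseudoComponents X, x ∈ P :=
  ⟨_, ⟨x, rfl⟩, Or.inl rfl⟩

theorem nonempty_of_mem_pseudoComponents {P : Set X} (hP : P ∈ pseudoComponents X) :
    P.Nonempty := by
  obtain ⟨z, rfl⟩ := hP
  exact ⟨z, Or.inl rfl⟩

theorem pairwiseDisjoint_pseudoComponents : (pseudoComponents X).PairwiseDisjoint id := by
  intro P hP Q hQ hne
  refine Set.disjoint_left.2 fun x hx hx' => hne (Set.ext fun y => ⟨fun hy => ?_, fun hy => ?_⟩)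
  · exact mem_of_pseudoEquiv hQ hx' (pseudoEquiv_of_mem hP hx hy)
  · exact mem_of_pseudoEquiv hP hx (pseudoEquiv_of_mem hQ hx' hy)

/-- A compact union of pseudo-components involves only finitely many of them. -/
theorem finite_of_isCompact_sUnion [LocallyCompactSpace X] {S : Set (Set X)}
    (hS : S ⊆ pseudoComponents X) (hc : IsCompact (⋃₀ S)) : S.Finite := by
  obtain ⟨T, hTS, hT, hcov⟩ := hc.elim_finite_subcover_image (b := S) (c := id)
    (fun P hP => (isClopen_of_mem_pseudoComponents (hS hP)).isOpen) (by simp [Set.sUnion_eq_biUnion])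
  refine hT.subset fun P hP => ?_
  obtain ⟨x, hx⟩ := nonempty_of_mem_pseudoComponents (hS hP)
  obtain ⟨Q, hQ, hxQ⟩ := Set.mem_iUnion₂.1 (hcov ⟨P, hP, hx⟩)
  by_contra hPT
  exact Set.disjoint_left.1
    (pairwiseDisjoint_pseudoComponents (hS hP) (hS (hTS hQ)) fun h => hPT (h ▸ hQ)) hx hxQ

/-! ### Convergence of isometries -/

/-- Invariance and the Lipschitz bound give ρ(z) ≤ ρ(z'), so some ball about `z'` of radius larger
than d(z,w) has compact closure; it contains `g w` as soon as `g z` is near `z'`. -/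
theorem exists_tendsto_of_compactnessRel {U : Ultrafilter (X ≃ᵢ X)} {z w z' : X}
    (hz : Tendsto (fun g : X ≃ᵢ X => g z) U (𝓝 z')) (h : CompactnessRel z w) :
    ∃ w', Tendsto (fun g : X ≃ᵢ X => g w) U (𝓝 w') := by
  have hρ : compactnessRadius z ≤ compactnessRadius z' := by
    have h0 : Tendsto (fun g : X ≃ᵢ X => compactnessRadius z' + edist (g z) z') U
        (𝓝 (compactnessRadius z')) := by
      simpa using tendsto_const_nhds.add (tendsto_iff_edist_tendsto_0.1 hz)
    refine ge_of_tendsto' h0 fun g => ?_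
    rw [← compactnessRadius_isometryEquiv g z]
    exact compactnessRadius_le_add_edist _ _
  obtain ⟨r, hr, hc⟩ := exists_isCompact_of_lt_compactnessRadius (lt_of_lt_of_le h hρ)
  have hr' : dist z w < r := by
    rw [edist_dist] at hr
    exact (ENNReal.ofReal_lt_ofReal_iff_of_nonneg dist_nonneg).1 hr
  have hev : ∀ᶠ g : X ≃ᵢ X in U, g w ∈ closure (Metric.ball z' r) := by
    filter_upwards [Metric.tendsto_nhds.1 hz (r - dist z w) (by linarith)] with g hg
    refine subset_closure ?_
    have := dist_triangle (g w) (g z) z'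
    rw [g.dist_eq, dist_comm w z] at this
    rw [Metric.mem_ball]
    linarith
  obtain ⟨w', -, hw'⟩ := hc.ultrafilter_le_nhds' (U.map fun g : X ≃ᵢ X => g w) hev
  exact ⟨w', hw'⟩

theorem exists_tendsto_of_pseudoEquiv {U : Ultrafilter (X ≃ᵢ X)} {z w z' : X}
    (hz : Tendsto (fun g : X ≃ᵢ X => g z) U (𝓝 z')) (h : PseudoEquiv z w) :
    ∃ w', Tendsto (fun g : X ≃ᵢ X => g w) U (𝓝 w') := by
  rcases h with rfl | ⟨h, -⟩
  · exact ⟨z', hz⟩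
  · induction h with
    | single h => exact exists_tendsto_of_compactnessRel hz h
    | tail _ h ih =>
      obtain ⟨_, ih⟩ := ih
      exact exists_tendsto_of_compactnessRel ih h

theorem tendsto_symm_apply {l : Filter (X ≃ᵢ X)} {x y : X}
    (h : Tendsto (fun g : X ≃ᵢ X => g x) l (𝓝 y)) :
    Tendsto (fun g : X ≃ᵢ X => g.symm y) l (𝓝 x) := by
  rw [tendsto_iff_dist_tendsto_zero] at h ⊢
  refine h.congr fun g => ?_
  rw [← g.dist_eq (g.symm y) x, g.apply_symm_apply, dist_comm]

theorem isInducing_isometryEquiv_apply :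
    IsInducing (fun (g : X ≃ᵢ X) (x : X) => g x) := ⟨rfl⟩

theorem nhds_isometryEquiv_le_iff {l : Filter (X ≃ᵢ X)} {g : X ≃ᵢ X} :
    l ≤ 𝓝 g ↔ ∀ x, Tendsto (fun h : X ≃ᵢ X => h x) l (𝓝 (g x)) := by
  rw [← tendsto_id', isInducing_isometryEquiv_apply.tendsto_nhds_iff, tendsto_pi_nhds]
  rfl

theorem continuous_isometryEquiv_apply (x : X) : Continuous fun g : X ≃ᵢ X => g x :=
  (continuous_apply x).comp isInducing_isometryEquiv_apply.continuous

instance isometryGroup_t2Space : T2Space (X ≃ᵢ X) :=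
  (IsEmbedding.mk isInducing_isometryEquiv_apply
    fun _ _ h => IsometryEquiv.ext fun x => congrFun h x).t2Space

instance isometryGroup_continuousSMul : ContinuousSMul (X ≃ᵢ X) X := by
  refine ⟨continuous_iff_continuousAt.2 fun ⟨g, x⟩ => ?_⟩
  have h1 : Tendsto (fun p : (X ≃ᵢ X) × X => dist (p.1 x) (g x) + dist p.2 x) (𝓝 (g, x))
      (𝓝 0) := by
    have : Continuous fun p : (X ≃ᵢ X) × X => dist (p.1 x) (g x) + dist p.2 x := by
      have := (continuous_isometryEquiv_apply x).comp (continuous_fst (X := X ≃ᵢ X) (Y := X))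
      exact (this.dist continuous_const).add (continuous_snd.dist continuous_const)
    simpa using this.tendsto (g, x)
  refine tendsto_iff_dist_tendsto_zero.2
    (squeeze_zero (fun _ => dist_nonneg) (fun p => ?_) h1)
  have := dist_triangle (p.1 p.2) (p.1 x) (g x)
  rw [p.1.dist_eq] at this
  change dist (p.1 p.2) (g x) ≤ _
  linarith

/-- An ultrafilter of isometries converges in the group if both it and its inverse converge at
every point. -/
theorem exists_le_nhds_of_tendsto {U : Ultrafilter (X ≃ᵢ X)}
    (h : ∀ z, ∃ z', Tendsto (fun g : X ≃ᵢ X => g z) U (𝓝 z'))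
    (k : ∀ z, ∃ z', Tendsto (fun g : X ≃ᵢ X => g.symm z) U (𝓝 z')) :
    ∃ g : X ≃ᵢ X, (U : Filter (X ≃ᵢ X)) ≤ 𝓝 g := by
  choose f hf using h
  choose f' hf' using k
  have hiso : Isometry f := by
    refine Isometry.of_dist_eq fun x y => ?_
    refine tendsto_nhds_unique ((hf x).dist (hf y)) ?_
    simp only [IsometryEquiv.dist_eq]
    exact tendsto_const_nhds
  refine ⟨IsometryEquiv.mk' f f' (fun y => ?_) hiso, nhds_isometryEquiv_le_iff.2 hf⟩
  have h2 : Tendsto (fun g : X ≃ᵢ X => g (f' y)) U (𝓝 y) := by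
    have := tendsto_symm_apply (l := (U : Filter (X ≃ᵢ X)).map IsometryEquiv.symm)
      (x := y) (y := f' y) (tendsto_map'_iff.2 (hf' y))
    exact this
  exact tendsto_nhds_unique (hf _) h2

/-! ### The group acting on a pseudo-component with compact complement -/

variable {P : Set X}

theorem apply_mem_of_unique_noncompact (hP : P ∈ pseudoComponents X) (hnc : ¬ IsCompact P)
    (hu : ∀ Q ∈ pseudoComponents X, ¬ IsCompact Q → Q = P) (g : X ≃ᵢ X) {x : X} (hx : x ∈ P) :
    g x ∈ P := by
  have himg : g '' P ∈ pseudoComponents X := by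
    refine ⟨g x, Set.ext fun y => ⟨?_, fun hy => ⟨g.symm y, ?_, by simp⟩⟩⟩
    · rintro ⟨z, hz, rfl⟩
      exact pseudoEquiv_isometryEquiv g (pseudoEquiv_of_mem hP hz hx)
    · refine mem_of_pseudoEquiv hP hx (pseudoEquiv_equivalence.symm ?_)
      simpa using pseudoEquiv_isometryEquiv g.symm hy
  have : ¬ IsCompact (g '' P) := by
    rwa [← g.coe_toHomeomorph, g.toHomeomorph.isCompact_image]
  rw [← hu _ himg this]
  exact ⟨x, hx, rfl⟩

/-- If `P` is an invariant pseudo-component with compact complement, then an ultrafilter of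
isometries converging at a point of `P` to a point of `P` converges in the group. -/
theorem exists_le_nhds_of_tendsto_apply (hP : P ∈ pseudoComponents X)
    (hinv : ∀ (g : X ≃ᵢ X) x, x ∈ P → g x ∈ P) (hc : IsCompact Pᶜ)
    {U : Ultrafilter (X ≃ᵢ X)} {x y : X} (hx : x ∈ P) (hy : y ∈ P)
    (h : Tendsto (fun g : X ≃ᵢ X => g x) U (𝓝 y)) :
    ∃ g : X ≃ᵢ X, (U : Filter (X ≃ᵢ X)) ≤ 𝓝 g := by
  have key : ∀ (V : Ultrafilter (X ≃ᵢ X)) {a b : X}, a ∈ P →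
      Tendsto (fun g : X ≃ᵢ X => g a) V (𝓝 b) →
      ∀ z, ∃ z', Tendsto (fun g : X ≃ᵢ X => g z) V (𝓝 z') := by
    intro V a b ha hab z
    by_cases hz : z ∈ P
    · exact exists_tendsto_of_pseudoEquiv hab (pseudoEquiv_of_mem hP ha hz)
    · have hev : ∀ g : X ≃ᵢ X, g z ∈ Pᶜ := fun g hg => hz (by simpa using hinv g.symm _ hg)
      obtain ⟨w, -, hw⟩ := hc.ultrafilter_le_nhds' (V.map fun g : X ≃ᵢ X => g z)
        (mem_map.2 (univ_mem' hev))
      exact ⟨w, hw⟩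
  -- The inverses converge at `y` to `x`, so `y ∈ P` lets the same argument run for them.
  exact exists_le_nhds_of_tendsto (key U hx h)
    (key (U.map IsometryEquiv.symm) hy (tendsto_symm_apply h))

theorem locallyCompactSpace_isometryGroup [LocallyCompactSpace X] (hP : P ∈ pseudoComponents X)
    (hinv : ∀ (g : X ≃ᵢ X) x, x ∈ P → g x ∈ P) (hc : IsCompact Pᶜ) :
    LocallyCompactSpace (X ≃ᵢ X) := by
  have : WeaklyLocallyCompactSpace (X ≃ᵢ X) := by
    refine ⟨fun g => ?_⟩
    obtain ⟨x, hx⟩ := nonempty_of_mem_pseudoComponents hP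
    obtain ⟨K, hK, hgx⟩ := exists_compact_mem_nhds (g x)
    refine ⟨{h | h x ∈ K}, isCompact_iff_ultrafilter_le_nhds'.2 fun U hU => ?_,
      (continuous_isometryEquiv_apply x).continuousAt hgx⟩
    obtain ⟨y, hyK, hy⟩ := hK.ultrafilter_le_nhds' (U.map fun g : X ≃ᵢ X => g x) hU
    have hyP : y ∈ P := (isClopen_of_mem_pseudoComponents hP).isClosed.mem_of_tendsto hy
      (Eventually.of_forall fun g : X ≃ᵢ X => hinv g x hx)
    obtain ⟨h, hh⟩ := exists_le_nhds_of_tendsto_apply hP hinv hc hx hyP hy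
    refine ⟨h, ?_, hh⟩
    rw [Set.mem_ofPred_eq, tendsto_nhds_unique (nhds_isometryEquiv_le_iff.1 hh x) hy]
    exact hyK
  infer_instance

theorem properSMul_isometryGroup (hP : P ∈ pseudoComponents X) (hc : IsCompact Pᶜ)
    (A : SubMulAction (X ≃ᵢ X) X) (hA : (A : Set X) = P) : ProperSMul (X ≃ᵢ X) A := by
  refine ⟨isProperMap_iff_ultrafilter_of_t2.2
    ⟨continuous_smul.prodMk continuous_snd, fun U ⟨y, x⟩ hU => ?_⟩⟩
  have hinv : ∀ (g : X ≃ᵢ X) x, x ∈ P → g x ∈ P := by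
    subst hA
    exact fun g x hx => A.smul_mem g hx
  have hx : Tendsto (fun p : (X ≃ᵢ X) × A => p.2) U (𝓝 x) :=
    ((continuous_snd (X := A) (Y := A)).tendsto (y, x)).comp hU
  have hy : Tendsto (fun p : (X ≃ᵢ X) × A => p.1 (p.2 : X)) U (𝓝 (y : X)) :=
    ((continuous_subtype_val.comp (continuous_fst (X := A) (Y := A))).tendsto (y, x)).comp hU
  have hgx : Tendsto (fun g : X ≃ᵢ X => g (x : X)) (U.map Prod.fst) (𝓝 (y : X)) := by
    rw [Ultrafilter.coe_map, tendsto_map'_iff]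
    -- The moving point can be replaced by its limit `x`, since `g` preserves the distance between
    -- them.
    have h1 := tendsto_iff_dist_tendsto_zero.1
      ((continuous_subtype_val.tendsto x).comp hx)
    refine hy.congr_dist (h1.congr fun p => ?_)
    exact (p.1.dist_eq _ _).symm
  obtain ⟨g, hg⟩ := exists_le_nhds_of_tendsto_apply hP hinv hc
    (hA ▸ x.2 : (x : X) ∈ P) (hA ▸ y.2 : (y : X) ∈ P) hgx
  refine ⟨(g, x), ?_⟩
  rw [nhds_prod_eq, le_prod]
  exact ⟨hg, hx⟩

end PseudoComponentLemmas

/-! ### Spaces with one end -/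

section OneEnd

open Filter Set

theorem isTopologicalBasis_isClopen_of_discreteTopology (α : Type*) [TopologicalSpace α]
    [DiscreteTopology α] : TopologicalSpace.IsTopologicalBasis {s : Set α | IsClopen s} := by
  simpa using TopologicalSpace.isTopologicalBasis_opens (α := α)

theorem HasOneEnd.noncompactSpace {X : Type u} [TopologicalSpace X] (h : HasOneEnd X) :
    NoncompactSpace X := by
  obtain ⟨Y, _, ι, hι, e, he, -⟩ := h
  have hι := hι.isZeroDimCompactification
  have := hι.t2Space
  refine not_compactSpace_iff.1 fun _ => he ?_
  have := (isCompact_range hι.isDenseEmbedding.continuous).isClosed.closure_eq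
  rw [hι.isDenseEmbedding.dense.closure_range] at this
  exact this ▸ mem_univ e

/-- A space with a closed-open set `A` is the topological sum of `A` and its complement. -/
noncomputable def IsClopen.sumComplHomeomorph {X : Type u} [TopologicalSpace X] {A : Set X}
    (hA : IsClopen A) : A ⊕ (Aᶜ : Set X) ≃ₜ X := by
  classical
  exact (Equiv.Set.sumCompl A).toHomeomorphOfContinuousOpen
    (by
      have : ⇑(Equiv.Set.sumCompl A) = Sum.elim (fun a : A => (a : X))
          (fun a : (Aᶜ : Set X) => (a : X)) := by
        ext (x | x) <;> rfl
      rw [this]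
      fun_prop)
    (isOpenMap_sum.2 ⟨hA.isOpen.isOpenMap_subtype_val, hA.compl.isOpen.isOpenMap_subtype_val⟩)

/-- Compactifying each half by its own point leaves a two-point, hence discrete, remainder. -/
theorem isZeroDimCompactification_twoPoint {X : Type u} [TopologicalSpace X] [T2Space X]
    [LocallyCompactSpace X] {A : Set X} (hA : IsClopen A) (h : ¬ IsCompact A)
    (h' : ¬ IsCompact Aᶜ) :
    IsZeroDimCompactification (Y := OnePoint A ⊕ OnePoint (Aᶜ : Set X))
      (Sum.map (↑) (↑) ∘ hA.sumComplHomeomorph.symm) := by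
  have : NoncompactSpace A := ⟨fun hc => h (isCompact_iff_isCompact_univ.2 hc)⟩
  have : NoncompactSpace (Aᶜ : Set X) := ⟨fun hc => h' (isCompact_iff_isCompact_univ.2 hc)⟩
  have : LocallyCompactSpace A := hA.isOpen.locallyCompactSpace
  have : LocallyCompactSpace (Aᶜ : Set X) := hA.compl.isOpen.locallyCompactSpace
  have hemb : IsOpenEmbedding
      (Sum.map (↑) (↑) : A ⊕ (Aᶜ : Set X) → OnePoint A ⊕ OnePoint (Aᶜ : Set X)) :=
    .of_continuous_injective_isOpenMap
      (OnePoint.continuous_coe.sumMap OnePoint.continuous_coe)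
      (OnePoint.coe_injective.sumMap OnePoint.coe_injective)
      (OnePoint.isOpenMap_coe.sumMap OnePoint.isOpenMap_coe)
  have hdense : DenseRange
      (Sum.map (↑) (↑) : A ⊕ (Aᶜ : Set X) → OnePoint A ⊕ OnePoint (Aᶜ : Set X)) := by
    rintro (x | x)
    · refine closure_mono ?_ (image_closure_subset_closure_image continuous_inl
        ⟨x, OnePoint.denseRange_coe x, rfl⟩)
      rintro _ ⟨_, ⟨y, rfl⟩, rfl⟩
      exact ⟨Sum.inl y, rfl⟩
    · refine closure_mono ?_ (image_closure_subset_closure_image continuous_inr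
        ⟨x, OnePoint.denseRange_coe x, rfl⟩)
      rintro _ ⟨_, ⟨y, rfl⟩, rfl⟩
      exact ⟨Sum.inr y, rfl⟩
  refine ⟨inferInstance, inferInstance,
    { hemb.isEmbedding.comp hA.sumComplHomeomorph.symm.isEmbedding with
      dense := hdense.comp hA.sumComplHomeomorph.symm.surjective.denseRange hemb.continuous }, ?_⟩
  have hfin : ((range ((Sum.map (↑) (↑) : A ⊕ (Aᶜ : Set X) → OnePoint A ⊕ OnePoint (Aᶜ : Set X)) ∘
      hA.sumComplHomeomorph.symm))ᶜ).Finite := by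
    refine (toFinite {Sum.inl OnePoint.infty, Sum.inr OnePoint.infty}).subset fun z hz => ?_
    rw [hA.sumComplHomeomorph.symm.surjective.range_comp] at hz
    rcases z with z | z <;> induction z using OnePoint.rec with
    | infty => simp
    | coe x => simp at hz
  have := hfin.to_subtype
  exact isTopologicalBasis_isClopen_of_discreteTopology _

/-- In a one-ended space, a closed-open set or its complement is compact. -/
theorem HasOneEnd.isCompact_or_isCompact_compl {X : Type u} [TopologicalSpace X] [T2Space X]
    [LocallyCompactSpace X] (h : HasOneEnd X) {A : Set X} (hA : IsClopen A) :
    IsCompact A ∨ IsCompact Aᶜ := by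
  by_contra! hc
  obtain ⟨Y, _, ι, hι, e, he, hu⟩ := h
  have hZ := isZeroDimCompactification_twoPoint hA hc.1 hc.2
  have := hι.isZeroDimCompactification.compactSpace
  have := hZ.t2Space
  obtain ⟨f, hf, hfι⟩ := hι.maximal _ _ hZ
  have hsurj : Function.Surjective f := by
    rw [← range_eq_univ, ← (isCompact_range hf).isClosed.closure_eq,
      ← dense_iff_closure_eq]
    refine hZ.isDenseEmbedding.dense.mono ?_
    rw [← hfι]
    exact range_comp_subset_range _ _
  obtain ⟨a, ha⟩ := hsurj (Sum.inl OnePoint.infty)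
  obtain ⟨b, hb⟩ := hsurj (Sum.inr OnePoint.infty)
  -- Points of `X` go to finite points, so preimages of both infinities are ends and must coincide.
  have hae : a = e := hu a <| by
    rintro ⟨x, rfl⟩
    rw [← Function.comp_apply (f := f), hfι] at ha
    rcases hx : hA.sumComplHomeomorph.symm x with z | z <;> simp [hx] at ha
  have hbe : b = e := hu b <| by
    rintro ⟨x, rfl⟩
    rw [← Function.comp_apply (f := f), hfι] at hb
    rcases hx : hA.sumComplHomeomorph.symm x with z | z <;> simp [hx] at hb
  rw [hae] at ha
  rw [hbe, ha] at hb
  cases hb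

variable {X : Type u} [MetricSpace X] [LocallyCompactSpace X]

theorem HasOneEnd.finite_pseudoComponents (h : HasOneEnd X) : (pseudoComponents X).Finite := by
  by_contra hinf
  -- Split into two infinite families: one of them would have compact union.
  obtain ⟨S, hS, hSi, hSd⟩ : ∃ S ⊆ pseudoComponents X, S.Infinite ∧
      (pseudoComponents X \ S).Infinite := by
    obtain ⟨S, T, hST, hd, hS⟩ :=
      Set.Infinite.exists_union_disjoint_cardinal_eq_of_infinite hinf
    have hiff : S.Finite ↔ T.Finite := by
      rw [← Cardinal.lt_aleph0_iff_set_finite, hS, Cardinal.lt_aleph0_iff_set_finite]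
    have hSi : S.Infinite := fun hf => hinf (hST ▸ hf.union (hiff.1 hf))
    refine ⟨S, hST ▸ subset_union_left, hSi, ?_⟩
    rw [← hST, union_sdiff_left, hd.symm.sdiff_eq_left]
    exact fun hf => hSi (hiff.2 hf)
  rcases h.isCompact_or_isCompact_compl (isClopen_sUnion_pseudoComponents hS) with hc | hc
  · exact hSi (finite_of_isCompact_sUnion hS hc)
  · refine hSd (finite_of_isCompact_sUnion sdiff_subset ?_)
    refine hc.of_isClosed_subset (isClopen_sUnion_pseudoComponents sdiff_subset).isClosed ?_
    rintro x ⟨P, hP, hx⟩ ⟨Q, hQ, hxQ⟩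
    exact disjoint_left.1 (pairwiseDisjoint_pseudoComponents hP.1 (hS hQ)
      fun hPQ => hP.2 (hPQ ▸ hQ)) hx hxQ

theorem HasOneEnd.existsUnique_not_isCompact (h : HasOneEnd X) :
    ∃! P : Set X, P ∈ pseudoComponents X ∧ ¬ IsCompact P := by
  obtain ⟨P, hP, hPc⟩ : ∃ P ∈ pseudoComponents X, ¬ IsCompact P := by
    by_contra! hall
    have := h.noncompactSpace
    refine noncompact_univ X ?_
    convert h.finite_pseudoComponents.isCompact_sUnion hall
    exact (sUnion_eq_univ_iff.2 exists_mem_pseudoComponents).symm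
  refine ⟨P, ⟨hP, hPc⟩, fun Q ⟨hQ, hQc⟩ => ?_⟩
  by_contra hne
  refine hQc (((h.isCompact_or_isCompact_compl
    (isClopen_of_mem_pseudoComponents hP)).resolve_left hPc).of_isClosed_subset
    (isClopen_of_mem_pseudoComponents hQ).isClosed ?_)
  exact (pairwiseDisjoint_pseudoComponents hQ hP hne).subset_compl_right

theorem HasOneEnd.isCompact_compl (h : HasOneEnd X) {P : Set X} (hP : P ∈ pseudoComponents X)
    (hPc : ¬ IsCompact P) : IsCompact Pᶜ :=
  (h.isCompact_or_isCompact_compl (isClopen_of_mem_pseudoComponents hP)).resolve_left hPc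

theorem HasOneEnd.apply_mem (h : HasOneEnd X) {P : Set X} (hP : P ∈ pseudoComponents X)
    (hPc : ¬ IsCompact P) (g : X ≃ᵢ X) {x : X} (hx : x ∈ P) : g x ∈ P :=
  apply_mem_of_unique_noncompact hP hPc
    (fun _ hQ hQc => h.existsUnique_not_isCompact.unique ⟨hQ, hQc⟩ ⟨hP, hPc⟩) g hx

theorem HasOneEnd.exists_properSMul (h : HasOneEnd X) {P : Set X} (hP : P ∈ pseudoComponents X)
    (hPc : ¬ IsCompact P) :
    ∃ A : SubMulAction (X ≃ᵢ X) X, (A : Set X) = P ∧ ProperSMul (X ≃ᵢ X) A :=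
  ⟨⟨P, fun g _ hx => h.apply_mem hP hPc g hx⟩, rfl,
    properSMul_isometryGroup hP (h.isCompact_compl hP hPc) _ rfl⟩

end OneEnd

/-! ### A connectedness criterion for having one end -/

section OneEndCriterion

open Filter Set

theorem IsDenseEmbedding.isOpen_range_of_locallyCompactSpace {X Z : Type*} [TopologicalSpace X]
    [LocallyCompactSpace X] [TopologicalSpace Z] [T2Space Z] {j : X → Z} (hj : IsDenseEmbedding j) : IsOpen (range j) := by
  rw [isOpen_iff_mem_nhds]
  rintro _ ⟨x, rfl⟩
  obtain ⟨K, hK, hx⟩ := exists_compact_mem_nhds x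
  obtain ⟨V, hV, hVo, hxV⟩ := mem_nhds_iff.1 hx
  obtain ⟨W, hW, rfl⟩ := hj.isEmbedding.isOpen_iff.1 hVo
  refine mem_of_superset (hW.mem_nhds hxV) ?_
  refine (hj.dense.open_subset_closure_inter hW).trans ?_
  refine (closure_minimal ?_ (hK.image hj.continuous).isClosed).trans (image_subset_range _ _)
  rintro _ ⟨hz, x, rfl⟩
  exact ⟨x, hV hz, rfl⟩

/-- A noncompact locally compact Hausdorff space has one end if its compact sets with connected
complement are cofinal among its compact sets. -/
theorem hasOneEnd_of_isPreconnected_compl {X : Type u} [TopologicalSpace X] [T2Space X]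
    [LocallyCompactSpace X] [NoncompactSpace X]
    (h : ∀ K : Set X, IsCompact K → ∃ L, IsCompact L ∧ K ⊆ L ∧ IsPreconnected Lᶜ) :
    HasOneEnd X := by
  refine ⟨OnePoint X, inferInstance, (↑), ⟨⟨inferInstance, inferInstance,
    OnePoint.isDenseEmbedding_coe, ?_⟩, ?_⟩, OnePoint.infty, by simp, ?_⟩
  · have : (range ((↑) : X → OnePoint X))ᶜ.Finite := by
      simp [OnePoint.compl_range_coe]
    have := this.to_subtype
    exact isTopologicalBasis_isClopen_of_discreteTopology _
  · intro Z _ j hj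
    have := hj.compactSpace
    have := hj.t2Space
    have hd := hj.isDenseEmbedding
    have hR := hd.isOpen_range_of_locallyCompactSpace
    have hne : (range j)ᶜ.Nonempty := by
      rw [nonempty_compl]
      intro hu
      refine noncompact_univ X (hd.isEmbedding.isCompact_iff.2 ?_)
      rw [image_univ, hu]
      exact isCompact_univ
    have hsub : (range j)ᶜ.Subsingleton := by
      intro a ha b hb
      by_contra hab
      -- A clopen `C` separates two remainder points. Disjoint open `U`, `V` around `C` and its
      -- complement leave a compact part of `X` uncovered; a connected complement of a larger
      -- compact `L` would meet both `U` and `V`, yet lie in their union.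
      obtain ⟨C, hC, haC, hCb⟩ := hj.isTopologicalBasis_isClopen.exists_subset_of_mem_open
        (show (⟨a, ha⟩ : ((range j)ᶜ : Set Z)) ∈ ({⟨b, hb⟩}ᶜ : Set _) by simpa using hab)
        isOpen_compl_singleton
      have hCl : ∀ D : Set ((range j)ᶜ : Set Z), IsClosed D →
          IsCompact ((↑) '' D : Set Z) := fun D hD =>
        (hR.isClosed_compl.isClosedMap_subtype_val D hD).isCompact
      obtain ⟨U, V, hU, hV, hCU, hCV, hUV⟩ := SeparatedNhds.of_isCompact_isCompact
        (hCl C hC.isClosed) (hCl Cᶜ hC.compl.isClosed)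
        ((disjoint_image_iff Subtype.val_injective).2 disjoint_compl_right)
      have hcov : (U ∪ V)ᶜ ⊆ range j := by
        intro z hz
        by_contra hzR
        by_cases hzC : (⟨z, hzR⟩ : ((range j)ᶜ : Set Z)) ∈ C
        · exact hz (Or.inl (hCU ⟨_, hzC, rfl⟩))
        · exact hz (Or.inr (hCV ⟨_, hzC, rfl⟩))
      obtain ⟨L, hL, hKL, hLc⟩ := h (j ⁻¹' (U ∪ V)ᶜ) (by
        rw [hd.isEmbedding.isCompact_iff, image_preimage_eq_of_subset hcov]
        exact (hU.union hV).isClosed_compl.isCompact)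
      have hmeet : ∀ W : Set Z, IsOpen W → ∀ z ∈ W, z ∉ range j → (Lᶜ ∩ j ⁻¹' W).Nonempty := by
        intro W hW z hz hzj
        obtain ⟨_, ⟨hW', hL'⟩, x, rfl⟩ := hd.dense.inter_open_nonempty (W ∩ (j '' L)ᶜ)
          (hW.inter (hL.image hd.continuous).isClosed.isOpen_compl)
          ⟨z, hz, fun hz' => hzj (image_subset_range _ _ hz')⟩
        exact ⟨x, fun hx => hL' ⟨x, hx, rfl⟩, hW'⟩
      obtain ⟨x, -, hx⟩ := hLc (j ⁻¹' U) (j ⁻¹' V) (hU.preimage hd.continuous)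
        (hV.preimage hd.continuous) (fun x hx => by_contra fun hx' => hx (hKL hx'))
        (hmeet U hU a (hCU ⟨_, haC, rfl⟩) ha)
        (hmeet V hV b (hCV ⟨⟨b, hb⟩, fun hbC => hCb hbC rfl, rfl⟩) hb)
      exact disjoint_left.1 hUV hx.1 hx.2
    obtain ⟨z, hz⟩ := hne
    have hrange : range j = {z}ᶜ := by
      rw [← hsub.eq_singleton_of_mem hz, compl_compl]
    exact ⟨_, (OnePoint.equivOfIsEmbeddingOfRangeEq z j hd.isEmbedding hrange).continuous,
      funext fun x => OnePoint.equivOfIsEmbeddingOfRangeEq_apply_coe z j hd.isEmbedding hrange x⟩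
  · intro y hy
    induction y using OnePoint.rec with
    | infty => rfl
    | coe x => exact absurd ⟨x, rfl⟩ hy

end OneEndCriterion

/-! ### A plane with an isolated point on whose complement the isometries act nonproperly -/

section PointedPlane

open Set

/-- Polar coordinates: a product of a ray and the connected unit sphere maps onto this set. -/
theorem isPreconnected_compl_closedBall {E : Type*} [NormedAddCommGroup E] [NormedSpace ℝ E]
    (hE : 1 < Module.rank ℝ E) {R : ℝ} (hR : 0 ≤ R) :
    IsPreconnected (Metric.closedBall (0 : E) R)ᶜ := by
  have : (Metric.closedBall (0 : E) R)ᶜ =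
      (fun p : ℝ × E => p.1 • p.2) '' (Ioi R ×ˢ Metric.sphere (0 : E) 1) := by
    ext x
    simp only [mem_compl_iff, mem_closedBall_zero_iff, not_le, mem_image, mem_prod, mem_Ioi,
      mem_sphere_zero_iff_norm, Prod.exists]
    constructor
    · intro hx
      have hx0 : ‖x‖ ≠ 0 := (hR.trans_lt hx).ne'
      exact ⟨‖x‖, ‖x‖⁻¹ • x, ⟨hx, by simp [norm_smul, hx0]⟩, by simp [smul_smul, hx0]⟩
    · rintro ⟨t, v, ⟨ht, hv⟩, rfl⟩
      rw [norm_smul, hv, mul_one]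
      exact ht.trans_le (le_abs_self t)
  rw [this]
  exact (isPreconnected_Ioi.prod (isPreconnected_sphere hE 0 1)).image _
    continuous_smul.continuousOn

/-- The disjoint union of the complex plane and a point. -/
def PointedPlane : Type := ℂ ⊕ Unit

namespace PointedPlane

noncomputable instance : TopologicalSpace PointedPlane := inferInstanceAs (TopologicalSpace (ℂ ⊕ Unit))

instance : LocallyCompactSpace PointedPlane := by
  have : WeaklyLocallyCompactSpace (ℂ ⊕ Unit) := by
    refine ⟨fun x => ?_⟩
    rcases x with x | x
    · obtain ⟨K, hK, hx⟩ := exists_compact_mem_nhds x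
      exact ⟨_, hK.image continuous_inl, IsOpenMap.image_mem_nhds isOpenMap_inl hx⟩
    · exact ⟨_, (isCompact_univ (X := Unit)).image continuous_inr,
        IsOpenMap.image_mem_nhds isOpenMap_inr Filter.univ_mem⟩
  exact inferInstanceAs (LocallyCompactSpace (ℂ ⊕ Unit))

/-- The Euclidean distance on the plane truncated at `1`, with the extra point at distance `1` from
the plane. -/
noncomputable def truncDist : PointedPlane → PointedPlane → ℝ
  | .inl a, .inl b => min 1 (dist a b)
  | .inr _, .inr _ => 0
  | _, _ => 1

theorem isOpen_iff_truncDist (s : Set PointedPlane) :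
    IsOpen s ↔ ∀ x ∈ s, ∃ ε > 0, ∀ y, truncDist x y < ε → y ∈ s := by
  refine (isOpen_sum_iff (X := ℂ) (Y := Unit)).trans ⟨fun ⟨h, _⟩ => ?_, fun h => ⟨?_, ?_⟩⟩
  · rintro (a | a) ha
    · obtain ⟨ε, hε, hb⟩ := Metric.isOpen_iff.1 h a ha
      -- The cap `1` keeps the ball inside the plane and the truncation inactive.
      refine ⟨min ε 1, by positivity, ?_⟩
      rintro (b | b) hab
      · refine hb (Metric.mem_ball'.2 ?_)
        change min 1 (dist a b) < min ε 1 at hab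
        by_contra! hle
        have := min_le_min_left 1 hle
        rw [min_comm] at hab
        rw [min_comm, min_comm 1] at this
        linarith
      · exact absurd (hab : (1 : ℝ) < _) (min_le_right _ _).not_gt
    · refine ⟨1, one_pos, ?_⟩
      rintro (b | b) hab
      · exact absurd (hab : (1 : ℝ) < 1) (lt_irrefl _)
      · exact ha
  · refine Metric.isOpen_iff.2 fun a ha => ?_
    obtain ⟨ε, hε, hb⟩ := h _ ha
    exact ⟨ε, hε, fun b hab => hb (Sum.inl b)
      ((min_le_right _ _).trans_lt (Metric.mem_ball'.1 hab))⟩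
  · exact isOpen_discrete _

noncomputable instance : MetricSpace PointedPlane :=
  MetricSpace.ofDistTopology truncDist
    (by rintro (a | a) <;> simp [truncDist])
    (by rintro (a | a) (b | b) <;> simp [truncDist, dist_comm])
    (by
      rintro (a | a) (b | b) (c | c) <;> simp only [truncDist]
      · rcases min_cases 1 (dist a b) with h | h <;> rcases min_cases 1 (dist b c) with k | k <;>
          rw [h.1, k.1]
        · linarith [min_le_left 1 (dist a c)]
        · linarith [min_le_left 1 (dist a c), dist_nonneg (x := b) (y := c)]
        · linarith [min_le_left 1 (dist a c), dist_nonneg (x := a) (y := b)]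
        · exact (min_le_right _ _).trans (dist_triangle _ _ _)
      · have : 0 ≤ min 1 (dist a b) := by positivity
        linarith
      · linarith [min_le_left 1 (dist a c)]
      · norm_num
      · have : 0 ≤ min 1 (dist b c) := by positivity
        linarith
      · norm_num
      · norm_num
      · norm_num)
    isOpen_iff_truncDist
    (by
      rintro (a | a) (b | b) h <;> simp only [truncDist] at h
      · rcases min_cases 1 (dist a b) with k | k
        · linarith
        · rw [eq_of_dist_eq_zero (k.1.symm.trans h)]
      · norm_num at h
      · norm_num at h
      · rfl)

/-- A point of the plane. -/
def ofComplex (z : ℂ) : PointedPlane := Sum.inl z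

/-- The isolated point. -/
def pt : PointedPlane := Sum.inr ()

theorem isClosedEmbedding_ofComplex : IsClosedEmbedding ofComplex :=
  (IsClosedEmbedding.inl : IsClosedEmbedding (Sum.inl : ℂ → ℂ ⊕ Unit))

theorem eq_pt_or (x : PointedPlane) : x = pt ∨ ∃ z, x = ofComplex z := by
  rcases x with x | x
  · exact Or.inr ⟨x, rfl⟩
  · exact Or.inl rfl

theorem ofComplex_ne_pt (z : ℂ) : ofComplex z ≠ pt := Sum.inl_ne_inr

theorem dist_pt_ofComplex (z : ℂ) : dist pt (ofComplex z) = 1 := rfl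

instance : NoncompactSpace PointedPlane :=
  isClosedEmbedding_ofComplex.noncompactSpace

theorem hasOneEnd : HasOneEnd PointedPlane := by
  refine hasOneEnd_of_isPreconnected_compl fun K hK => ?_
  obtain ⟨R, hR, hKR⟩ := (isClosedEmbedding_ofComplex.isCompact_preimage
    hK).isBounded.subset_closedBall_lt 0 0
  refine ⟨ofComplex '' Metric.closedBall 0 R ∪ {pt},
    ((isCompact_closedBall 0 R).image isClosedEmbedding_ofComplex.continuous).union
      isCompact_singleton, fun x hx => ?_, ?_⟩
  · rcases eq_pt_or x with rfl | ⟨z, rfl⟩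
    · exact Or.inr rfl
    · exact Or.inl ⟨z, hKR hx, rfl⟩
  · convert (isPreconnected_compl_closedBall (E := ℂ) (by simp [Complex.rank_real_complex])
      hR.le).image ofComplex isClosedEmbedding_ofComplex.continuous.continuousOn
    ext x
    rcases eq_pt_or x with rfl | ⟨z, rfl⟩
    · simp [ofComplex_ne_pt]
    · simp [ofComplex_ne_pt, isClosedEmbedding_ofComplex.injective.eq_iff]

/-- A ball about `pt` of radius above `1` is the whole non-compact space, so ρ(pt) ≤ 1, the distance
to every point of the plane. -/
theorem eq_pt_of_compactnessRel {x : PointedPlane} (h : CompactnessRel pt x) : x = pt := by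
  rcases eq_pt_or x with rfl | ⟨z, rfl⟩
  · rfl
  obtain ⟨r, hr, hc⟩ := exists_isCompact_of_lt_compactnessRadius h
  rw [edist_dist, dist_pt_ofComplex,
    ENNReal.ofReal_lt_ofReal_iff_of_nonneg zero_le_one] at hr
  refine absurd (hc.of_isClosed_subset isClosed_univ fun x _ => subset_closure ?_)
    (noncompact_univ _)
  rw [Metric.mem_ball, dist_comm]
  rcases eq_pt_or x with rfl | ⟨z, rfl⟩
  · rw [dist_self]; linarith
  · rwa [dist_pt_ofComplex]

theorem eq_pt_of_pseudoEquiv {x : PointedPlane} (h : PseudoEquiv pt x) : x = pt := by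
  rcases h with h | ⟨h, -⟩
  · exact h.symm
  · induction h with
    | single h => exact eq_pt_of_compactnessRel h
    | tail _ h ih => exact eq_pt_of_compactnessRel (ih ▸ h)

/-- The translations of the plane, fixing the isolated point. -/
noncomputable def translation (w : ℂ) : PointedPlane ≃ᵢ PointedPlane :=
  IsometryEquiv.mk' (Sum.map (w + ·) id) (Sum.map (-w + ·) id)
    (by rintro (z | z) <;> simp <;> rfl)
    (by
      refine Isometry.of_dist_eq ?_
      rintro (z | z) (y | y)
      · change min 1 (dist (w + z) (w + y)) = min 1 (dist z y)
        rw [dist_add_left]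
      all_goals rfl)

theorem translation_apply (w z : ℂ) : translation w (ofComplex z) = ofComplex (w + z) := rfl

/-- Translations make the orbit of `0` contain the plane; a compact group would have compact orbits.
-/
theorem not_compactSpace_isometryGroup : ¬ CompactSpace (PointedPlane ≃ᵢ PointedPlane) := by
  intro h
  refine noncompact_univ PointedPlane
    (((isCompact_range (continuous_isometryEquiv_apply (ofComplex 0))).union
      (isCompact_singleton (x := pt))).of_isClosed_subset isClosed_univ fun x _ => ?_)
  rcases eq_pt_or x with rfl | ⟨z, rfl⟩
  · exact Or.inr rfl
  · exact Or.inl ⟨translation z, by simp [translation_apply]⟩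

end PointedPlane

/-- By properness `G × X`, the preimage of the compact `X × X`, is compact, and it projects onto
`G`. -/
theorem compactSpace_of_properSMul {G X : Type*} [Group G] [TopologicalSpace G]
    [TopologicalSpace X] [MulAction G X] [ProperSMul G X] [CompactSpace X] [Nonempty X] :
    CompactSpace G := by
  have h := (ProperSMul.isProperMap_smul_pair (G := G) (X := X)).isCompact_preimage isCompact_univ
  rw [preimage_univ] at h
  have := h.image continuous_fst
  rw [image_univ, Prod.fst_surjective.range_eq] at this
  exact ⟨this⟩

theorem exists_hasOneEnd_not_properSMul :
    ∃ (X : Type) (_ : MetricSpace X) (_ : LocallyCompactSpace X), HasOneEnd X ∧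
      ∃ P ∈ pseudoComponents X, ¬ IsCompact P ∧
        ∃ A : SubMulAction (X ≃ᵢ X) X, (A : Set X) = Pᶜ ∧ ¬ ProperSMul (X ≃ᵢ X) A := by
  have hX := PointedPlane.hasOneEnd
  obtain ⟨P, ⟨hP, hPc⟩, -⟩ := hX.existsUnique_not_isCompact
  have hpt : PointedPlane.pt ∉ P := fun h => hPc <| by
    have : P = {PointedPlane.pt} := Subset.antisymm
      (fun x hx => PointedPlane.eq_pt_of_pseudoEquiv (pseudoEquiv_of_mem hP h hx))
      (singleton_subset_iff.2 h)
    rw [this]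
    exact isCompact_singleton
  let A : SubMulAction (PointedPlane ≃ᵢ PointedPlane) PointedPlane :=
    ⟨Pᶜ, fun g x hx hgx => hx (by
      have := hX.apply_mem hP hPc g.symm hgx
      rwa [show g.symm (g • x) = x from g.symm_apply_apply x] at this)⟩
  refine ⟨PointedPlane, inferInstance, inferInstance, hX, P, hP, hPc, A, rfl, fun _ => ?_⟩
  have : CompactSpace A := isCompact_iff_compactSpace.1 (hX.isCompact_compl hP hPc)
  have : Nonempty A := ⟨⟨PointedPlane.pt, hpt⟩⟩
  exact PointedPlane.not_compactSpace_isometryGroup (compactSpace_of_properSMul (X := A))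

end PointedPlane

/-- An invariant subset `A` of `X`, with the action of the group of isometries on it, is a
`SubMulAction` with carrier `A`; it carries the subspace topology. -/
theorem theorem1p1 :
    (∀ (X : Type u) [MetricSpace X] [LocallyCompactSpace X], HasOneEnd X →
      (pseudoComponents X).Finite ∧
      (∃! P : Set X, P ∈ pseudoComponents X ∧ ¬ IsCompact P) ∧
      LocallyCompactSpace (X ≃ᵢ X) ∧
      ∀ P ∈ pseudoComponents X, ¬ IsCompact P →
        (∃ A : SubMulAction (X ≃ᵢ X) X, (A : Set X) = P ∧ ProperSMul (X ≃ᵢ X) A) ∧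
        IsCompact Pᶜ) ∧
    (∃ (X : Type) (_ : MetricSpace X) (_ : LocallyCompactSpace X), HasOneEnd X ∧
      ∃ P ∈ pseudoComponents X, ¬ IsCompact P ∧
        ∃ A : SubMulAction (X ≃ᵢ X) X, (A : Set X) = Pᶜ ∧ ¬ ProperSMul (X ≃ᵢ X) A) := by
  refine ⟨fun X _ _ h => ⟨h.finite_pseudoComponents, h.existsUnique_not_isCompact, ?_,
    fun P hP hPc => ⟨h.exists_properSMul hP hPc, h.isCompact_compl hP hPc⟩⟩,
    exists_hasOneEnd_not_properSMul⟩
  obtain ⟨P, ⟨hP, hPc⟩, -⟩ := h.existsUnique_not_isCompact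
  exact locallyCompactSpace_isometryGroup hP (fun g _ => h.apply_mem hP hPc g)
    (h.isCompact_compl hP hPc)
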